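/- Let $N\subseteq M$ be von Neumann algebras acting on a Hilbert space and let $E:M\to N$ be a faithful normal conditional expectation. Let $\mathcal U_M$ be the unitary group of $M$ with the norm topology. For $u\in\mathcal U_M$ and a bounded operator $T$ on $M$ put $L_u(T)(x)=u\,T(u^*xu)\,u^*$. Let $\mathcal U(E)=\{L_u(E):u\in\mathcal U_M\}$ be the unitary orbit of $E$, with the quotient topology induced by the map $u\mapsto L_u(E)$. Let $$\mathcal N_E=\{u\in\mathcal U_M: E(uxu^*)=uE(x)u^*\ \text{for all }x\in M\},\qquad M_E=\{x\in N'\cap M: E(xm)=E(mx)\ \text{for all } m\in M\},$$ and let $\mathcal H_E=\{vw: v\in\mathcal U_N,\ w\in\mathcal U_{M_E}\}$, where $\mathcal U_N$ and $\mathcal U_{M_E}$ are the groups of unitaries in $N$ and in $M_E$; $\mathcal H_E$ is a normal subgroup of $\mathcal N_E$. Let $\mathcal X(E)=\mathcal U_M/\mathcal H_E$ with the quotient topology, and let $\Psi:\mathcal X(E)\to\mathcal U(E)$, $\Psi(u\mathcal H_E)=L_u(E)$. Let $W(E)=\pi_0(\mathcal N_E)$ be the Weyl group of $E$, i.e. the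 group of connected components of $\mathcal N_E$ in the norm topology. Then, for every base point $x_0\in\mathcal X(E)$, the group $\Psi_*(\pi_1(\mathcal X(E),x_0))$ is a normal subgroup of $\pi_1(\mathcal U(E),\Psi(x_0))$, and there are group isomorphisms $$\pi_1(\mathcal U(E),\Psi(x_0))\,/\,\Psi_*(\pi_1(\mathcal X(E),x_0))\;\simeq\; W(E)\;\simeq\;\mathcal N_E/\mathcal H_E .$$ -/

import Mathlib

section WeylGroupOfExpectation

variable {H : Type*} [NormedAddCommGroup H] [InnerProductSpace ℂ H] [CompleteSpace H]

/-- A faithful normal conditional expectation `E : M → N` between von Neumann algebras `N ⊆ M`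
acting on `H`, regarded as a bounded operator on `M`. The norm and the order of `M` are those
inherited from the bounded operators on `H`. -/
structure FaithfulNormalCondExp (M N : VonNeumannAlgebra H) where
  /-- `N` is a von Neumann subalgebra of `M`. -/
  le : N ≤ M
  /-- The underlying bounded operator on `M`. -/
  toCLM : M.toStarSubalgebra →L[ℂ] M.toStarSubalgebra
  /-- `E` takes values in `N`. -/
  map_mem : ∀ x, (toCLM x : H →L[ℂ] H) ∈ N
  /-- `E` is the identity on `N`. -/
  map_of_mem : ∀ x : M.toStarSubalgebra, (x : H →L[ℂ] H) ∈ N → toCLM x = x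
  /-- `E` is an `N`-bimodule map. -/
  map_bimodule : ∀ a x b : M.toStarSubalgebra, (a : H →L[ℂ] H) ∈ N → (b : H →L[ℂ] H) ∈ N →
    toCLM (a * x * b) = a * toCLM x * b
  /-- `E` is positive. -/
  map_nonneg : ∀ x : M.toStarSubalgebra, 0 ≤ (x : H →L[ℂ] H) → 0 ≤ (toCLM x : H →L[ℂ] H)
  /-- `E` is faithful. -/
  faithful : ∀ x, toCLM (star x * x) = 0 → x = 0
  /-- `E` is normal: it preserves suprema of bounded increasing nets of self-adjoint elements. -/
  normal : ∀ (s : Set M.toStarSubalgebra) (a : M.toStarSubalgebra), s.Nonempty →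
    DirectedOn (· ≤ ·) s → (∀ x ∈ s, IsSelfAdjoint x) → IsLUB s a → IsLUB (toCLM '' s) (toCLM a)

namespace FaithfulNormalCondExp

/-- The action `L_u(T) = u T(u⁻¹ · u) u⁻¹` of a unitary `u` of `M` on a bounded operator `T`
on `M`. -/
noncomputable def conjAct {M : VonNeumannAlgebra H} (u : unitary M.toStarSubalgebra)
    (T : M.toStarSubalgebra →L[ℂ] M.toStarSubalgebra) :
    M.toStarSubalgebra →L[ℂ] M.toStarSubalgebra where
  toFun x := (u : M.toStarSubalgebra) * T (star (u : M.toStarSubalgebra) * x * u) *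
    star (u : M.toStarSubalgebra)
  map_add' x y := by simp only [mul_add, add_mul, map_add]
  map_smul' c x := by simp
  cont := by fun_prop

variable {M N : VonNeumannAlgebra H} (E : FaithfulNormalCondExp M N)

/-- The normalizer `N_E` of `E`: the unitaries `u` of `M` with `E(u x u*) = u E(x) u*` for all
`x` in `M`. -/
def normalizer : Subgroup (unitary M.toStarSubalgebra) where
  carrier := {u | ∀ x : M.toStarSubalgebra,
    E.toCLM (u * x * star (u : M.toStarSubalgebra)) =
      u * E.toCLM x * star (u : M.toStarSubalgebra)}
  one_mem' x := by simp
  mul_mem' {u v} hu hv x := by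
    have := hu (v * x * star (v : M.toStarSubalgebra))
    rw [hv] at this
    simpa [mul_assoc] using this
  inv_mem' {u} hu x := by
    have h1 : (u : M.toStarSubalgebra) * star (u : M.toStarSubalgebra) = 1 :=
      Unitary.coe_mul_star_self u
    have h2 := Unitary.coe_star_mul_self u
    rw [← Unitary.star_eq_inv, Unitary.coe_star, star_star]
    generalize hU : (u : M.toStarSubalgebra) = U at *
    generalize hV : star U = V at *
    have h : E.toCLM (U * (V * x * U) * V) = U * E.toCLM (V * x * U) * V := by
      have := hu (V * x * U)
      rwa [hU, hV] at this
    have e : U * (V * x * U) * V = x := by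
      rw [show U * (V * x * U) * V = (U * V) * x * (U * V) by simp only [mul_assoc], h1]; simp
    rw [e] at h
    rw [h, show V * (U * E.toCLM (V * x * U) * V) * U = (V * U) * E.toCLM (V * x * U) * (V * U) by
      simp only [mul_assoc], h2]
    simp

/-- The centralizer `M_E = {x ∈ N' ∩ M : E(x m) = E(m x) for all m ∈ M}` of `E`. -/
def centralizer : Set M.toStarSubalgebra :=
  {x | (x : H →L[ℂ] H) ∈ N.commutant ∧ ∀ m, E.toCLM (x * m) = E.toCLM (m * x)}

/-- The subgroup `H_E = U_N · U_{M_E}` of the unitary group of `M`: the products `v w` of a unitary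
`v` in `N` and a unitary `w` in `M_E`. -/
def unitaryProduct : Subgroup (unitary M.toStarSubalgebra) where
  carrier := {u | ∃ v w : unitary M.toStarSubalgebra,
    ((v : M.toStarSubalgebra) : H →L[ℂ] H) ∈ N ∧ (w : M.toStarSubalgebra) ∈ E.centralizer ∧
      u = v * w}
  one_mem' := ⟨1, 1, by simp, by simp [centralizer], by simp⟩
  mul_mem' := by
    rintro _ _ ⟨v, w, hv, hw, rfl⟩ ⟨v', w', hv', hw', rfl⟩
    refine ⟨v * v', w * w', by simpa using mul_mem hv hv', ⟨by simpa using mul_mem hw.1 hw'.1,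
      fun m => ?_⟩, ?_⟩
    · have h1 := hw.2 (w' * m)
      have h2 := hw'.2 (m * w)
      simp only [Submonoid.coe_mul, mul_assoc] at *
      rw [h1, h2]
    · have h : w * v' = v' * w := by
        ext1; ext1
        simpa using (VonNeumannAlgebra.mem_commutant_iff.1 hw.1 _ hv').symm
      rw [mul_assoc, ← mul_assoc w, h]; simp only [mul_assoc]
  inv_mem' := by
    rintro _ ⟨v, w, hv, hw, rfl⟩
    have h : w * v = v * w := by
      ext1; ext1
      simpa using (VonNeumannAlgebra.mem_commutant_iff.1 hw.1 _ hv).symm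
    refine ⟨v⁻¹, w⁻¹, ?_, ⟨?_, fun m => ?_⟩, ?_⟩
    · rw [← Unitary.star_eq_inv]; exact star_mem hv
    · rw [← Unitary.star_eq_inv]; exact star_mem hw.1
    · have h1 : (w : M.toStarSubalgebra) * star (w : M.toStarSubalgebra) = 1 :=
      Unitary.coe_mul_star_self w
      have h2 := Unitary.coe_star_mul_self w
      have h3 := hw.2 (star (w : M.toStarSubalgebra) * m * star (w : M.toStarSubalgebra))
      rw [← Unitary.star_eq_inv, Unitary.coe_star]
      rw [show ∀ a b : M.toStarSubalgebra, a * (b * m * b) = (a * b) * (m * b) by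
        intros; simp only [mul_assoc], mul_assoc _ _ (w : M.toStarSubalgebra), h1, h2, one_mul,
        mul_one] at h3
      exact h3.symm
    · rw [← h, mul_inv_rev]

/-- `H_E` is contained in `N_E`. -/
theorem unitaryProduct_le_normalizer : E.unitaryProduct ≤ E.normalizer := by
  rintro _ ⟨v, w, hv, hw, rfl⟩
  refine mul_mem (fun x => E.map_bimodule _ _ _ hv (star_mem hv)) (fun x => ?_)
  have h1 : (w : M.toStarSubalgebra) * star (w : M.toStarSubalgebra) = 1 :=
    Unitary.coe_mul_star_self w
  have h2 := Unitary.coe_star_mul_self w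
  have h3 : (w : M.toStarSubalgebra) * E.toCLM x = E.toCLM x * w := by
    ext1
    exact (VonNeumannAlgebra.mem_commutant_iff.1 hw.1 _ (E.map_mem x)).symm
  rw [h3, mul_assoc, hw.2, mul_assoc, h2, mul_assoc, h1, mul_one, mul_one]

/-- `H_E` is normal in `N_E`. -/
instance unitaryProduct_normal : (E.unitaryProduct.subgroupOf E.normalizer).Normal where
  conj_mem := by
    rintro ⟨_, _⟩ ⟨v, w, hv, hw, rfl⟩ ⟨u, hu⟩
    have hN : ∀ g ∈ E.normalizer, ∀ n : M.toStarSubalgebra, (n : H →L[ℂ] H) ∈ N →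
        ((g * n * star (g : M.toStarSubalgebra) : M.toStarSubalgebra) : H →L[ℂ] H) ∈ N := by
      intro g hg n hn
      have := hg n
      rw [E.map_of_mem n hn] at this
      rw [← this]
      exact E.map_mem _
    have hu' : ∀ x : M.toStarSubalgebra, E.toCLM (u * x * star (u : M.toStarSubalgebra)) =
      u * E.toCLM x * star (u : M.toStarSubalgebra) := hu
    have h1 : (u : M.toStarSubalgebra) * star (u : M.toStarSubalgebra) = 1 :=
      Unitary.coe_mul_star_self u
    have h2 := Unitary.coe_star_mul_self u
    refine ⟨u * v * u⁻¹, u * w * u⁻¹, hN u hu v hv, ⟨?_, fun m => ?_⟩, ?_⟩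
    · rw [VonNeumannAlgebra.mem_commutant_iff]
      intro g hg
      have hgM : g ∈ M.toStarSubalgebra := E.le hg
      have h3 := hN u⁻¹ (inv_mem hu) ⟨g, hgM⟩ hg
      have h4 := VonNeumannAlgebra.mem_commutant_iff.1 hw.1 _ h3
      rw [← Unitary.star_eq_inv] at h4 ⊢
      have h5 : star (u : M.toStarSubalgebra) * ⟨g, hgM⟩ * u * w =
          w * (star (u : M.toStarSubalgebra) * ⟨g, hgM⟩ * u) := by
        ext1
        simpa using h4
      have h6 : (⟨g, hgM⟩ : M.toStarSubalgebra) * (u * w * star (u : M.toStarSubalgebra)) =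
          (u * w * star (u : M.toStarSubalgebra)) * ⟨g, hgM⟩ := by
        generalize (⟨g, hgM⟩ : M.toStarSubalgebra) = G at h5 ⊢
        have : (u : M.toStarSubalgebra) * (star (u : M.toStarSubalgebra) * G * u * w) *
            star (u : M.toStarSubalgebra) = u * (w * (star (u : M.toStarSubalgebra) * G * u)) *
            star (u : M.toStarSubalgebra) := by rw [h5]
        rw [show ∀ U V G W : M.toStarSubalgebra, U * (V * G * U * W) * V =
          (U * V) * (G * (U * W * V)) by intros; simp only [mul_assoc],
          show ∀ U V G W : M.toStarSubalgebra, U * (W * (V * G * U)) * V =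
          (U * W * V) * G * (U * V) by intros; simp only [mul_assoc], h1, one_mul, mul_one]
          at this
        exact this
      exact congrArg Subtype.val h6
    · rw [← Unitary.star_eq_inv]
      simp only [Submonoid.coe_mul, Unitary.coe_star]
      have h3 := hw.2 (star (u : M.toStarSubalgebra) * m * u)
      have h4 := hu' (w * (star (u : M.toStarSubalgebra) * m * u))
      have h5 := hu' (star (u : M.toStarSubalgebra) * m * u * w)
      rw [h3, ← h5] at h4
      rw [show ∀ U V W : M.toStarSubalgebra, U * (W * (V * m * U)) * V =
        (U * W * V) * m * (U * V) by intros; simp only [mul_assoc],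
        show ∀ U V W : M.toStarSubalgebra, U * (V * m * U * W) * V =
        (U * V) * (m * (U * W * V)) by intros; simp only [mul_assoc], h1, one_mul, mul_one] at h4
      exact h4
    · simp [mul_assoc]

/-- The identity component of `N_E` (in the norm topology) is normal in `N_E`. -/
instance identityComponent_normal :
    (Subgroup.connectedComponentOfOne E.normalizer).Normal where
  conj_mem n hn g := by
    have hc : Continuous fun x : E.normalizer => g * x * g⁻¹ := by fun_prop
    have h := hc.image_connectedComponent_subset 1 ⟨n, hn, rfl⟩
    rw [mul_one, mul_inv_cancel] at h
    exact h

/-- The Weyl group `W(E) = π₀(N_E)`: the group of connected components of `N_E` in the norm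
topology, that is, the quotient of `N_E` by its identity component. -/
abbrev WeylGroup : Type _ :=
  E.normalizer ⧸ Subgroup.connectedComponentOfOne E.normalizer

/-- The space `X(E) = U_M / H_E` of left cosets `u H_E`, with the quotient topology of the norm
topology of `U_M`. -/
abbrev CoverSpace : Type _ :=
  unitary M.toStarSubalgebra ⧸ E.unitaryProduct

/-- The unitary orbit `U(E) = {L_u(E) : u ∈ U_M}`. -/
def UnitaryOrbit : Type _ :=
  Set.range fun u : unitary M.toStarSubalgebra => conjAct u E.toCLM

/-- The map `Π_E : U_M → U(E)`, `u ↦ L_u(E)`. -/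
noncomputable def toOrbit (u : unitary M.toStarSubalgebra) : E.UnitaryOrbit :=
  ⟨conjAct u E.toCLM, u, rfl⟩

/-- `U(E)` carries the quotient topology of the norm topology of `U_M` under `Π_E`. -/
noncomputable instance : TopologicalSpace E.UnitaryOrbit :=
  TopologicalSpace.coinduced E.toOrbit inferInstance

theorem toOrbit_mul_of_mem {u h : unitary M.toStarSubalgebra} (hh : h ∈ E.unitaryProduct) :
    E.toOrbit (u * h) = E.toOrbit u := by
  have h1 : (h : M.toStarSubalgebra) * star (h : M.toStarSubalgebra) = 1 :=
    Unitary.coe_mul_star_self h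
  refine Subtype.ext (ContinuousLinearMap.ext fun x => ?_)
  have key : ∀ y : M.toStarSubalgebra, h * E.toCLM (star (h : M.toStarSubalgebra) * y * h) *
      star (h : M.toStarSubalgebra) = E.toCLM y := by
    intro y
    have h2 := E.unitaryProduct_le_normalizer hh (star (h : M.toStarSubalgebra) * y * h)
    rw [← h2, show ∀ U V : M.toStarSubalgebra, U * (V * y * U) * V =
      (U * V) * y * (U * V) by intros; simp only [mul_assoc], h1, one_mul, mul_one]
  have h3 := key (star (u : M.toStarSubalgebra) * x * u)
  change ((u * h : unitary M.toStarSubalgebra) : M.toStarSubalgebra) * E.toCLM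
      (star ((u * h : unitary M.toStarSubalgebra) : M.toStarSubalgebra) * x *
        (u * h : unitary M.toStarSubalgebra)) *
      star ((u * h : unitary M.toStarSubalgebra) : M.toStarSubalgebra) =
    u * E.toCLM (star (u : M.toStarSubalgebra) * x * u) * star (u : M.toStarSubalgebra)
  rw [← h3]
  simp only [Submonoid.coe_mul, star_mul, mul_assoc]

/-- The covering map `X(E) → U(E)`, `u H_E ↦ L_u(E)`. -/
noncomputable def coveringMap : C(E.CoverSpace, E.UnitaryOrbit) where
  toFun := Quotient.lift E.toOrbit fun u u' huu' => by
    rw [← E.toOrbit_mul_of_mem (QuotientGroup.leftRel_apply.1 huu'), mul_inv_cancel_left]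
  continuous_toFun := Continuous.quotient_lift continuous_coinduced_rng _

end FaithfulNormalCondExp

end WeylGroupOfExpectation

/-!
The map `Ψ : X(E) → U(E)` is a regular covering with deck group `N_E / H_E` and path connected
total space, so `π₁(U(E))` modulo the image of `π₁(X(E))` is the deck group
(`IsQuotientCoveringMap.exists_normal_quotient_range_mulEquiv`). Three facts are needed.

* `H_E` is open in `N_E`, so that `U_M / H_E → U_M / N_E` is a covering
  (`Subgroup.isQuotientCoveringMap_coset`). If `u ∈ N_E` is near `1`, then `y = E(u)` is invertible,
  and the relation `E(u) n = (u n u*) E(u)` for `n ∈ N` gives `u* y ∈ N'`. Hence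
  `|y| = |u* y|` lies in `N ∩ N'`, the unitary part `v` of `y` lies in `N`, and `v* u` is a unitary
  of `N'` normalizing `E`, which means that it lies in `M_E`
  (`FaithfulNormalCondExp.mem_unitaryProduct_of_isUnit`).

* The unitary groups of `M`, `N` and `M_E` are path connected in norm
  (`StarSubalgebra.ContainsKernelLimits.joined_one`). Instead of a Borel logarithm, the proof uses
  a single spectral projection `p` separating the positive from the negative part of `Re u`: then
  `u` is the product of unitaries, each at distance less than `2` from `1`. The projection is
  `1 - Q`, with `Q` the strong limit of `(1 - b) ^ n` and `b` the positive part of `Re u`.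

* `M_E` contains these strong limits (`FaithfulNormalCondExp.kernelLimit_mem_centralizer`). This is
  where the normality of `E` enters: it gives `E((1 - b) ^ n - Q) → 0`, and the Cauchy–Schwarz
  inequality for the functionals `x ↦ ⟪ξ, E(x) ξ⟫` lets the identity `E(x m) = E(m x)` pass to the
  limit.

The second and third facts make `H_E` path connected; being open as well, it is the identity
component of `N_E`, so that `N_E / H_E` is the Weyl group
(`FaithfulNormalCondExp.connectedComponentOfOne_normalizer`).
-/

open Topology Filter Function
open scoped ComplexOrder

/-! ### Coverings of coset spaces and fundamental groups -/

section CosetCovering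

variable {G : Type*} [Group G]

/-- For `H ≤ N ≤ G` with `H` normal in `N`, the left action of `N ⧸ H` on the left cosets `G ⧸ H` in
which the class of `n` sends `u H` to `u n⁻¹ H`. -/
@[reducible]
def Subgroup.cosetMulAction (H N : Subgroup G) [(H.subgroupOf N).Normal] (hHN : H ≤ N) :
    MulAction (N ⧸ H.subgroupOf N) (G ⧸ H) where
  smul := Quotient.map₂ (fun (n : N) (u : G) => u * (n : G)⁻¹) <| by
    intro n n' hn u u' hu
    replace hn : n⁻¹ * n' ∈ H.subgroupOf N := QuotientGroup.leftRel_apply.1 hn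
    replace hu : u⁻¹ * u' ∈ H := QuotientGroup.leftRel_apply.1 hu
    refine QuotientGroup.leftRel_apply.2 ?_
    have h1 := (inferInstance : (H.subgroupOf N).Normal).conj_mem ⟨u⁻¹ * u', hHN hu⟩ hu n
    have h2 := (inferInstance : (H.subgroupOf N).Normal).conj_mem _ (inv_mem hn) n
    have h3 := mul_mem h1 h2
    rw [Subgroup.mem_subgroupOf] at h3
    convert! h3 using 1
    simp [mul_assoc]
  one_smul x := by
    induction x using QuotientGroup.induction_on with
    | H u => exact congrArg _ (by simp : u * ((1 : N) : G)⁻¹ = u)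
  mul_smul a b x := by
    induction x using QuotientGroup.induction_on with
    | H u =>
      induction a using QuotientGroup.induction_on with
      | H a =>
        induction b using QuotientGroup.induction_on with
        | H b =>
          exact congrArg _ (by simp [mul_assoc] :
            u * ((a * b : N) : G)⁻¹ = u * (b : G)⁻¹ * (a : G)⁻¹)

variable [TopologicalSpace G] [IsTopologicalGroup G]

/-- If `H` is open in `N` near `1`, the projection `G ⧸ H → G ⧸ N` is a covering whose deck group is
`N ⧸ H`. The base is any space `X` with the quotient topology of a map `G → X` whose fibres are the
left cosets of `N`. -/
theorem Subgroup.isQuotientCoveringMap_coset {X : Type*} [TopologicalSpace X]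
    (H N : Subgroup G) [(H.subgroupOf N).Normal] (hHN : H ≤ N) {O : Set G} (hO : O ∈ 𝓝 1)
    (hON : ∀ g ∈ O, g ∈ N → g ∈ H) (f : G ⧸ H → X)
    (hf : IsQuotientMap fun u : G => f u) (hfN : ∀ u v : G, f u = f v ↔ u⁻¹ * v ∈ N) :
    letI := H.cosetMulAction N hHN
    IsQuotientCoveringMap f (N ⧸ H.subgroupOf N) := by
  let := H.cosetMulAction N hHN
  have hcont : Continuous f :=
    (QuotientGroup.isQuotientMap_mk (N := H)).continuous_iff.2 hf.continuous
  refine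
    { toIsQuotientMap := .of_comp QuotientGroup.continuous_mk hcont hf
      continuous_const_smul := fun g => ?_
      apply_eq_iff_mem_orbit := fun {x y} => ?_
      disjoint := fun x => ?_ }
  · induction g using QuotientGroup.induction_on with
    | H n =>
      refine (QuotientGroup.isQuotientMap_mk (N := H)).continuous_iff.2 ?_
      exact QuotientGroup.continuous_mk.comp (continuous_mul_const _)
  · induction x using QuotientGroup.induction_on with
    | H u =>
      induction y using QuotientGroup.induction_on with
      | H v =>
        rw [hfN]
        constructor
        · intro h
          refine ⟨((⟨u⁻¹ * v, h⟩ : N) : N ⧸ H.subgroupOf N), ?_⟩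
          change (((v * (u⁻¹ * v)⁻¹ : G)) : G ⧸ H) = u
          simp
        · rintro ⟨g, hg⟩
          induction g using QuotientGroup.induction_on with
          | H n =>
            have h1 := QuotientGroup.eq.1 (hg : ((v * (n : G)⁻¹ : G) : G ⧸ H) = u)
            have h2 := mul_mem (inv_mem (hHN h1)) (n.2)
            convert! h2 using 1
            simp [mul_assoc]
  · induction x using QuotientGroup.induction_on with
    | H u =>
      -- `W` is chosen with `w₁⁻¹ * w₂ ∈ O` for `w₁ w₂ ∈ W`;
      -- the neighbourhood is the image of `u W`.
      obtain ⟨W, hW, hWO⟩ : ∃ W ∈ 𝓝 (1 : G), ∀ a ∈ W, ∀ b ∈ W, a⁻¹ * b ∈ O := by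
        have hc : Filter.Tendsto (fun p : G × G => p.1⁻¹ * p.2) (𝓝 (1, 1)) (𝓝 1) := by
          have : Continuous fun p : G × G => p.1⁻¹ * p.2 := by fun_prop
          simpa using this.tendsto (1, 1)
        rw [nhds_prod_eq] at hc
        obtain ⟨A, hA, B, hB, h⟩ := Filter.mem_prod_iff.1 (hc hO)
        exact ⟨A ∩ B, Filter.inter_mem hA hB, fun a ha b hb => h (Set.mk_mem_prod ha.1 hb.2)⟩
      refine ⟨(fun w : G => ((u * w : G) : G ⧸ H)) '' W, ?_, fun g hg => ?_⟩
      · have ho : IsOpenMap fun w : G => ((u * w : G) : G ⧸ H) :=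
          QuotientGroup.isOpenMap_coe.comp (isOpenMap_mul_left u)
        simpa using ho.image_mem_nhds hW
      · induction g using QuotientGroup.induction_on with
        | H n =>
          obtain ⟨_, ⟨_, ⟨a, ha, rfl⟩, rfl⟩, b, hb, hab⟩ := hg
          have h1 : (u * b)⁻¹ * (u * a * (n : G)⁻¹) ∈ H :=
            QuotientGroup.eq.1 (hab : ((u * b : G) : G ⧸ H) = (u * a * (n : G)⁻¹ : G))
          have h2 : b⁻¹ * a * (n : G)⁻¹ ∈ H := by convert! h1 using 1; group
          have h3 : b⁻¹ * a ∈ H := hON _ (hWO b hb a ha) <| by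
            simpa using mul_mem (hHN h2) n.2
          refine (QuotientGroup.eq_one_iff n).2 (Subgroup.mem_subgroupOf.2 ?_)
          simpa [mul_assoc] using mul_mem (inv_mem h2) h3

end CosetCovering

section DeckGroup

variable {E X : Type*} [TopologicalSpace E] [TopologicalSpace X]

/-- The fundamental group of the base of a path connected covering with deck group `G`, modulo
the image of the fundamental group of the total space, is isomorphic to `G`. -/
theorem IsQuotientCoveringMap.exists_normal_quotient_range_mulEquiv [PathConnectedSpace E]
    {G : Type*} [Group G] [MulAction G E] (f : C(E, X)) (hf : IsQuotientCoveringMap f G) (e : E) :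
    ∃ _ : (FundamentalGroup.map f e).range.Normal,
      Nonempty (FundamentalGroup X (f e) ⧸ (FundamentalGroup.map f e).range ≃* G) := by
  let φ := hf.fundamentalGroupToMulOpposite (x := f e) ⟨e, rfl⟩
  have hker : φ.ker = (FundamentalGroup.map f e).range := by
    rw [hf.ker_fundamentalGroupToMulOpposite, hf.ker_monodromyPerm ⟨e, rfl⟩]
    congr 1
    ext p
    exact (FundamentalGroup.mapOfEq_apply f rfl p).trans (Path.Homotopic.Quotient.cast_rfl_rfl _)
  rw [← hker]
  -- monodromy is an antihomomorphism to the deck group, whence the opposite group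
  exact ⟨inferInstance, ⟨(QuotientGroup.quotientKerEquivOfSurjective φ
    (hf.fundamentalGroupToMulOpposite_surjective _)).trans (MulEquiv.inv' G).symm⟩⟩

end DeckGroup

/-! ### Strong limits of positive operators -/

section StrongLimit

variable {H : Type*} [NormedAddCommGroup H] [InnerProductSpace ℂ H]

theorem ContinuousLinearMap.commute_of_tendsto {y : ℕ → H →L[ℂ] H} {T x : H →L[ℂ] H}
    (h0 : ∀ n, Commute (y n) x) (hT : ∀ ξ, Tendsto (fun n => y n ξ) atTop (𝓝 (T ξ))) :
    Commute T x := by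
  ext ξ
  refine tendsto_nhds_unique (hT (x ξ)) ?_
  have h := (x.continuous.tendsto _).comp (hT ξ)
  refine h.congr fun n => ?_
  exact congrArg (· ξ) (h0 n).eq.symm

/-- `Q` is the strong limit of the powers of `1 - b`; for `0 ≤ b ≤ 1` it is the projection onto the
kernel of `b`. -/
def IsKernelLimit (b Q : H →L[ℂ] H) : Prop :=
  ∀ ξ, Tendsto (fun n : ℕ => ((1 - b) ^ n) ξ) atTop (𝓝 (Q ξ))

namespace IsKernelLimit

variable {b Q : H →L[ℂ] H} (hQ : IsKernelLimit b Q)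
include hQ

theorem commute {x : H →L[ℂ] H} (hx : Commute b x) : Commute Q x :=
  ContinuousLinearMap.commute_of_tendsto
    (fun n => ((Commute.one_left x).sub_left hx).pow_left n) hQ

/-- The limit satisfies `Q (1 - b) = Q`. -/
theorem mul_eq_zero : Q * b = 0 := by
  have h : Q * (1 - b) = Q := by
    ext ξ
    refine tendsto_nhds_unique (hQ ((1 - b) ξ)) ?_
    refine ((tendsto_add_atTop_iff_nat 1).2 (hQ ξ)).congr fun n => ?_
    rw [pow_succ]; rfl
  rwa [mul_sub, mul_one, sub_eq_self] at h

omit hQ in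
theorem mul_one_sub_pow {c : H →L[ℂ] H} (hc : c * b = 0) (n : ℕ) : c * (1 - b) ^ n = c := by
  induction n with
  | zero => simp
  | succ n ih => rw [pow_succ, ← mul_assoc, ih, mul_sub, hc, mul_one, sub_zero]

theorem mul_eq_self {c : H →L[ℂ] H} (hc : c * b = 0) : c * Q = c := by
  ext ξ
  refine tendsto_nhds_unique ((c.continuous.tendsto _).comp (hQ ξ)) ?_
  refine tendsto_const_nhds.congr fun n => ?_
  exact congrArg (· ξ) (mul_one_sub_pow hc n).symm

theorem isIdempotentElem : Q * Q = Q := hQ.mul_eq_self hQ.mul_eq_zero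

end IsKernelLimit

variable [CompleteSpace H]

/-- This is `d² ≤ ‖d‖ d`, evaluated at a vector. -/
theorem ContinuousLinearMap.norm_apply_sq_le_of_nonneg {d : H →L[ℂ] H} (hd : 0 ≤ d) (ξ : H) :
    ‖d ξ‖ ^ 2 ≤ ‖d‖ * RCLike.re (inner ℂ (d ξ) ξ) := by
  have hsa : IsSelfAdjoint d := .of_nonneg hd
  have h1 : d * d ≤ algebraMap ℝ (H →L[ℂ] H) ‖d‖ * d := by
    have hc : Commute d (algebraMap ℝ (H →L[ℂ] H) ‖d‖ - d) :=
      .sub_right (Algebra.commutes _ _).symm (.refl d)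
    have h := hc.mul_nonneg hd (sub_nonneg.2 hsa.le_algebraMap_norm_self)
    rwa [mul_sub, sub_nonneg, ← Algebra.commutes] at h
  have h2 := ((ContinuousLinearMap.le_def _ _).1 h1).re_inner_nonneg_left ξ
  have h3 : inner ℂ (d (d ξ)) ξ = inner ℂ (d ξ) (d ξ) := hsa.isSymmetric _ _
  rw [← Algebra.smul_def] at h2
  simp only [sub_apply, smul_apply, mul_apply_eq_comp, inner_sub_left, h3, map_sub,
    inner_self_eq_norm_sq, sub_nonneg, inner_smul_left_eq_smul] at h2
  simpa using h2

/-- A decreasing sequence of positive operators converges strongly. -/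
theorem ContinuousLinearMap.exists_tendsto_of_antitone {y : ℕ → H →L[ℂ] H} (hy : Antitone y)
    (h0 : ∀ n, 0 ≤ y n) : ∃ T : H →L[ℂ] H, ∀ ξ, Tendsto (fun n => y n ξ) atTop (𝓝 (T ξ)) := by
  -- The numbers `⟪y n ξ, ξ⟫` decrease, and they control `‖y n ξ - y m ξ‖ ^ 2`.
  suffices h : ∀ ξ, CauchySeq fun n => y n ξ by
    choose f hf using fun ξ => cauchySeq_tendsto_of_complete (h ξ)
    exact ⟨continuousLinearMapOfTendsto y (f := f) (tendsto_pi_nhds.2 hf), hf⟩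
  intro ξ
  set r : ℕ → ℝ := fun n => RCLike.re (inner ℂ (y n ξ) ξ) with hr
  have hrpos : ∀ n, 0 ≤ r n := fun n =>
    ((ContinuousLinearMap.nonneg_iff_isPositive _).1 (h0 n)).re_inner_nonneg_left ξ
  have hranti : Antitone r := fun n m hnm => by
    have := ((ContinuousLinearMap.le_def _ _).1 (hy hnm)).re_inner_nonneg_left ξ
    simpa [inner_sub_left, hr] using this
  have hbdd : BddBelow (Set.range r) := ⟨0, by rintro _ ⟨n, rfl⟩; exact hrpos n⟩
  have hlim := tendsto_atTop_ciInf hranti hbdd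
  have key : ∀ n m, n ≤ m → ‖y n ξ - y m ξ‖ ^ 2 ≤ (‖y 0‖ + 1) * (r n - r m) := by
    intro n m hnm
    have hd : 0 ≤ y n - y m := sub_nonneg.2 (hy hnm)
    have hle : y n - y m ≤ y 0 := (sub_le_self _ (h0 m)).trans (hy (Nat.zero_le n))
    have hn : ‖y n - y m‖ ≤ ‖y 0‖ := CStarAlgebra.norm_le_norm_of_nonneg_of_le hd hle
    have h := ContinuousLinearMap.norm_apply_sq_le_of_nonneg hd ξ
    simp only [sub_apply, inner_sub_left, map_sub] at h
    have h' : 0 ≤ r n - r m := sub_nonneg.2 (hranti hnm)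
    exact h.trans (mul_le_mul_of_nonneg_right (hn.trans (by linarith)) h')
  refine Metric.cauchySeq_iff'.2 fun ε hε => ?_
  have hC : 0 < ‖y 0‖ + 1 := by positivity
  obtain ⟨N, hN⟩ := (hlim.eventually_lt_const
    (lt_add_of_pos_right _ (by positivity : 0 < ε ^ 2 / (‖y 0‖ + 1)))).exists
  refine ⟨N, fun n hn => ?_⟩
  rw [dist_comm, dist_eq_norm]
  refine lt_of_pow_lt_pow_left₀ 2 hε.le ((key N n hn).trans_lt ?_)
  rw [← lt_div_iff₀' hC]
  linarith [ciInf_le hbdd n]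

theorem ContinuousLinearMap.nonneg_of_tendsto {y : ℕ → H →L[ℂ] H} {T : H →L[ℂ] H}
    (h0 : ∀ n, 0 ≤ y n) (hT : ∀ ξ, Tendsto (fun n => y n ξ) atTop (𝓝 (T ξ))) : 0 ≤ T := by
  have h : ∀ ξ, Tendsto (fun n => inner ℂ (y n ξ) ξ) atTop (𝓝 (inner ℂ (T ξ) ξ)) := fun ξ =>
    (hT ξ).inner tendsto_const_nhds
  rw [ContinuousLinearMap.nonneg_iff_isPositive, ContinuousLinearMap.isPositive_iff']
  have hpos : ∀ n ξ, 0 ≤ inner ℂ (y n ξ) ξ := fun n =>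
    ((ContinuousLinearMap.nonneg_iff_isPositive _).1 (h0 n)).inner_nonneg_left
  have hT0 : ∀ ξ, 0 ≤ inner ℂ (T ξ) ξ := fun ξ => ge_of_tendsto' (h ξ) fun n => hpos n ξ
  refine ⟨?_, hT0⟩
  rw [ContinuousLinearMap.isSelfAdjoint_iff_isSymmetric,
    LinearMap.isSymmetric_iff_inner_map_self_real]
  exact fun ξ => (RCLike.nonneg_iff.1 (hT0 ξ)).2 |> RCLike.conj_eq_iff_im.2

theorem ContinuousLinearMap.antitone_one_sub_pow {b : H →L[ℂ] H} (h0 : 0 ≤ b) (h1 : b ≤ 1) :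
    Antitone fun n : ℕ => (1 - b) ^ n := by
  refine antitone_nat_of_succ_le fun n => sub_nonneg.1 ?_
  have : (1 - b) ^ n - (1 - b) ^ (n + 1) = (1 - b) ^ n * b := by rw [pow_succ]; noncomm_ring
  rw [this]
  have hp : 0 ≤ (1 - b) ^ n := CStarAlgebra.pow_nonneg (sub_nonneg.2 h1) n
  exact (((Commute.one_left b).sub_left (.refl b)).pow_left n).mul_nonneg hp h0

theorem exists_isKernelLimit {b : H →L[ℂ] H} (h0 : 0 ≤ b) (h1 : b ≤ 1) :
    ∃ Q, IsKernelLimit b Q :=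
  ContinuousLinearMap.exists_tendsto_of_antitone
    (ContinuousLinearMap.antitone_one_sub_pow h0 h1)
    fun n => CStarAlgebra.pow_nonneg (sub_nonneg.2 h1) n

theorem IsKernelLimit.nonneg {b Q : H →L[ℂ] H} (hQ : IsKernelLimit b Q) (h1 : b ≤ 1) : 0 ≤ Q :=
  ContinuousLinearMap.nonneg_of_tendsto
    (fun n => CStarAlgebra.pow_nonneg (sub_nonneg.2 h1) n) hQ

theorem IsKernelLimit.le_one_sub_pow {b Q : H →L[ℂ] H} (hQ : IsKernelLimit b Q) (h0 : 0 ≤ b)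
    (h1 : b ≤ 1) (n : ℕ) : Q ≤ (1 - b) ^ n := by
  refine sub_nonneg.1 (ContinuousLinearMap.nonneg_of_tendsto
    (y := fun m => (1 - b) ^ n - (1 - b) ^ (m + n)) (fun m => sub_nonneg.2 ?_) fun ξ => ?_)
  · exact ContinuousLinearMap.antitone_one_sub_pow h0 h1 (Nat.le_add_left n m)
  · exact tendsto_const_nhds.sub ((tendsto_add_atTop_iff_nat n).2 (hQ ξ))

end StrongLimit

/-! ### Connectedness of unitary groups -/

section Joined

variable {A : Type*} [CStarAlgebra A]

/-- If a projection `q` commutes with `u`, the unitary `u q + (1 - q)` is joined to `1` as soon as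
`Re u` is bounded away from `-1` on the range of `q`. -/
theorem Unitary.joined_one_of_projection {u q : A} (hu : u ∈ unitary A) (hq : q * q = q)
    (hqs : star q = q) (hc : Commute u q) (hn : ‖q * (2 - u - star u)‖ < 4) :
    ∃ w : unitary A, (w : A) = u * q + (1 - q) ∧ Joined 1 w := by
  have hu1 : star u * u = 1 := Unitary.star_mul_self_of_mem hu
  have hu2 : u * star u = 1 := Unitary.mul_star_self_of_mem hu
  have hc2 : star u * q = q * star u := by
    have := congrArg star hc.eq
    rw [star_mul, star_mul, hqs] at this
    exact this.symm
  have hc1 : u * q = q * u := hc.eq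
  -- rewriting rules moving `q` to the left
  have hq' (x : A) : q * (q * x) = q * x := by rw [← mul_assoc, hq]
  have hc1' (x : A) : u * (q * x) = q * (u * x) := by rw [← mul_assoc, hc1, mul_assoc]
  have hc2' (x : A) : star u * (q * x) = q * (star u * x) := by rw [← mul_assoc, hc2, mul_assoc]
  have hs : star (u * q + (1 - q)) = q * star u + (1 - q) := by simp [hqs]
  have hw : u * q + (1 - q) ∈ unitary A := by
    rw [Unitary.mem_iff, hs]
    constructor <;>
      simp only [mul_add, add_mul, mul_sub, sub_mul, mul_one, one_mul, mul_assoc, hq, hq', hc1,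
        hc1', hc2, hc2', hu1, hu2] <;> abel
  refine ⟨⟨_, hw⟩, rfl, Unitary.joined _ _ ?_⟩
  have h : star (u * q + (1 - q) - 1) * (u * q + (1 - q) - 1) = q * (2 - u - star u) := by
    rw [star_sub, hs, star_one, ← one_add_one_eq_two]
    simp only [mul_add, add_mul, mul_sub, sub_mul, mul_one, one_mul, mul_assoc, hq, hq', hc1,
      hc2, hc2', hu1]
    abel
  change ‖u * q + (1 - q) - 1‖ < 2
  rw [← h, CStarRing.norm_star_mul_self] at hn
  nlinarith [norm_nonneg (u * q + (1 - q) - 1)]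

/-- A unitary `u` is joined to `1` if there is a projection `p` commuting with `u` which separates
the positive part `b` of `Re u` from its negative part `c`. -/
theorem Unitary.joined_one_of_posPart (u : unitary A) {p b c : A} (hp : p * p = p)
    (hps : star p = p) (hc : Commute (u : A) p) (hbc : (u : A) + star (u : A) = 2 * (b - c))
    (hpb : p * b = b) (hpc : p * c = 0) (hb : ‖1 - b‖ ≤ 1) (hc' : ‖1 - c‖ ≤ 1) :
    Joined 1 u := by
  have hq : (1 - p) * (1 - p) = 1 - p := by simp [mul_sub, sub_mul, hp]
  have hqs : star (1 - p) = 1 - p := by simp [hps]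
  have hstar : star (u : A) = 2 * (b - c) - u := by rw [← hbc, add_sub_cancel_left]
  have hbound {q x : A} (h1 : q * q = q) (h2 : star q = q) (hx : ‖x‖ ≤ 1) :
      ‖q * x + q * x‖ < 4 := by
    have h3 : ‖q‖ ≤ 1 := IsStarProjection.norm_le q ⟨h1, h2⟩
    have h4 : ‖q * x‖ ≤ 1 := (norm_mul_le q x).trans (mul_le_one₀ h3 (norm_nonneg x) hx)
    linarith [norm_add_le (q * x) (q * x)]
  have hone : ‖(1 : A)‖ ≤ 1 := IsStarProjection.norm_le 1 ⟨mul_one 1, star_one A⟩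
  -- `u` on the range of `p`, where `Re u ≥ 0`
  obtain ⟨w₁, hw₁, hj₁⟩ := Unitary.joined_one_of_projection u.2 hp hps hc <| by
    convert! hbound hp hps hb using 2
    rw [hstar, two_mul, ← one_add_one_eq_two]
    simp only [mul_add, mul_sub, mul_one, hpb, hpc]
    abel
  -- `-u` on the range of `1 - p`, where `Re u ≤ 0`
  obtain ⟨w₂, hw₂, hj₂⟩ := Unitary.joined_one_of_projection (u := -(u : A))
    (by simp [Unitary.mem_iff]) hq hqs ((Commute.one_right _).sub_right hc).neg_left <| by
    convert! hbound hq hqs hc' using 2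
    rw [star_neg, hstar, two_mul, ← one_add_one_eq_two]
    simp only [mul_add, mul_sub, sub_mul, mul_neg, mul_one, one_mul, hpb, hpc]
    abel
  -- the sign `-1` on the range of `1 - p` is the square of `i` there
  obtain ⟨w₃, hw₃, hj₃⟩ := Unitary.joined_one_of_projection (u := Complex.I • (1 : A))
    (by simp [Unitary.mem_iff, smul_smul]) hq hqs ((Commute.one_left _).smul_left _) <| by
    convert! hbound hq hqs hone using 2
    simp [mul_two]
  have h := hj₁.mul (hj₂.mul (hj₃.mul hj₃))
  simp only [mul_one] at h
  convert! h
  ext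
  simp only [Submonoid.coe_mul, hw₁, hw₂, hw₃]
  have hc1 : (u : A) * p = p * u := hc.eq
  have hp' (x : A) : p * (p * x) = p * x := by rw [← mul_assoc, hp]
  have hc1' (x : A) : (u : A) * (p * x) = p * (u * x) := by rw [← mul_assoc, hc1, mul_assoc]
  have h33 : (Complex.I • (1 : A) * (1 - p) + (1 - (1 - p))) *
      (Complex.I • (1 : A) * (1 - p) + (1 - (1 - p))) = p + p - 1 := by
    have h1 : (1 - p) * p = 0 := by simp [sub_mul, hp]
    have h2 : p * (1 - p) = 0 := by simp [mul_sub, hp]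
    rw [smul_one_mul, sub_sub_cancel, mul_add, add_mul, add_mul, smul_mul_smul_comm, hq,
      smul_mul_assoc, mul_smul_comm, h1, h2, hp, Complex.I_mul_I, neg_one_smul]
    simp only [smul_zero, add_zero, zero_add]
    abel
  rw [h33]
  simp only [mul_add, add_mul, mul_sub, sub_mul, mul_one, one_mul, mul_assoc, hp, hp', hc1,
    hc1', neg_mul, mul_neg]
  abel

end Joined

section UnitaryConnected

variable {H : Type*} [NormedAddCommGroup H] [InnerProductSpace ℂ H] [CompleteSpace H]

/-- A star subalgebra of `B(H)` which contains the kernel projections, given as strong limits, of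
its positive contractions. -/
def StarSubalgebra.ContainsKernelLimits (S : StarSubalgebra ℂ (H →L[ℂ] H)) : Prop :=
  ∀ b ∈ S, 0 ≤ b → b ≤ 1 → ∀ Q, IsKernelLimit b Q → Q ∈ S

/-- The unitary group of a norm closed star algebra of operators is path connected if the
algebra contains the kernel projections of its positive contractions. -/
theorem StarSubalgebra.ContainsKernelLimits.joined_one {S : StarSubalgebra ℂ (H →L[ℂ] H)}
    [hSc : IsClosed (S : Set (H →L[ℂ] H))] (hS : S.ContainsKernelLimits) (u : unitary S) :
    Joined 1 u := by
  set U : H →L[ℂ] H := ((u : S) : H →L[ℂ] H) with hU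
  have hUS : U ∈ S := (u : S).2
  have hU1 : star U * U = 1 := congrArg Subtype.val (Unitary.coe_star_mul_self u)
  have hU2 : U * star U = 1 := congrArg Subtype.val (Unitary.coe_mul_star_self u)
  have hUn : ‖U‖ ≤ 1 := (sq_le_one_iff₀ (norm_nonneg U)).1 <| by
    rw [sq, ← CStarRing.norm_star_mul_self, hU1]
    exact ContinuousLinearMap.norm_id_le
  -- `a = Re u`, and `Q` is the projection onto the kernel of its positive part
  set a : H →L[ℂ] H := (2⁻¹ : ℝ) • (U + star U) with ha
  have hasa : IsSelfAdjoint a := by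
    rw [IsSelfAdjoint, ha, star_smul, star_add, star_star, add_comm]; simp
  have haS : a ∈ S := S.toSubalgebra.smul_mem
    (add_mem hUS (star_mem hUS) : U + star U ∈ S) ((2⁻¹ : ℝ) : ℂ)
  have hbS : a⁺ ∈ S := cfcₙ_mem haS (f := _)
  have hcS : a⁻ ∈ S := cfcₙ_mem haS (f := _)
  have han : ‖a‖ ≤ 1 := by
    have h := norm_add_le U (star U)
    rw [norm_star] at h
    rw [ha, norm_smul, norm_inv, Real.norm_ofNat]
    linarith
  have hb0 : 0 ≤ a⁺ := CFC.posPart_nonneg a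
  have hc0 : 0 ≤ a⁻ := CFC.negPart_nonneg a
  have hle {x : H →L[ℂ] H} (hx : 0 ≤ x) (hn : ‖x‖ ≤ 1) : x ≤ 1 :=
    (CStarAlgebra.norm_le_one_iff_of_nonneg x hx).1 hn
  have hb1 : a⁺ ≤ 1 := hle hb0 ((CStarAlgebra.norm_posPart_le a).trans han)
  have hc1 : a⁻ ≤ 1 := hle hc0 ((CStarAlgebra.norm_negPart_le a).trans han)
  have hsub {x : H →L[ℂ] H} (hx : 0 ≤ x) (hx1 : x ≤ 1) : ‖1 - x‖ ≤ 1 :=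
    (CStarAlgebra.norm_le_one_iff_of_nonneg _ (sub_nonneg.2 hx1)).2 (sub_le_self _ hx)
  obtain ⟨Q, hQ⟩ := exists_isKernelLimit hb0 hb1
  have hQS : Q ∈ S := hS _ hbS hb0 hb1 Q hQ
  have hQs : star Q = Q := (IsSelfAdjoint.of_nonneg (hQ.nonneg hb1)).star_eq
  have hUa : Commute a U :=
    ((Commute.refl U).add_left ((hU1.trans hU2.symm : Commute (star U) U))).smul_left _
  have hQU : Commute Q U := hQ.commute (hUa.cfcₙ_real _)
  have hcQ : Q * a⁻ = a⁻ := by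
    have := congrArg star (hQ.mul_eq_self (CFC.negPart_mul_posPart a))
    rwa [star_mul, hQs, (IsSelfAdjoint.of_nonneg hc0).star_eq] at this
  refine Unitary.joined_one_of_posPart u (p := 1 - ⟨Q, hQS⟩) (b := ⟨a⁺, hbS⟩) (c := ⟨a⁻, hcS⟩)
    ?_ ?_ ?_ ?_ ?_ ?_ (hsub hb0 hb1) (hsub hc0 hc1) <;> try ext1
  · change (1 - Q) * (1 - Q) = 1 - Q
    simp [mul_sub, sub_mul, hQ.isIdempotentElem]
  · change star (1 - Q) = 1 - Q
    simp [hQs]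
  · change U * (1 - Q) = (1 - Q) * U
    exact ((Commute.one_right U).sub_right hQU.symm)
  · change U + star U = 2 * (a⁺ - a⁻)
    rw [CFC.posPart_sub_negPart a hasa, ha, mul_smul_comm, two_mul, ← two_smul ℝ, smul_smul]
    norm_num
  · change (1 - Q) * a⁺ = a⁺
    rw [sub_mul, hQ.mul_eq_zero, one_mul, sub_zero]
  · change (1 - Q) * a⁻ = 0
    rw [sub_mul, hcQ, one_mul, sub_self]

/-- A strong limit of operators in a von Neumann algebra belongs to it. -/
theorem VonNeumannAlgebra.mem_of_tendsto {M : VonNeumannAlgebra H} {y : ℕ → H →L[ℂ] H}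
    {T : H →L[ℂ] H} (hy : ∀ n, y n ∈ M)
    (hT : ∀ ξ, Tendsto (fun n => y n ξ) atTop (𝓝 (T ξ))) : T ∈ M := by
  rw [← M.commutant_commutant, VonNeumannAlgebra.mem_commutant_iff]
  intro g hg
  refine (ContinuousLinearMap.commute_of_tendsto (fun n => ?_) hT).eq.symm
  exact VonNeumannAlgebra.mem_commutant_iff.1 hg _ (hy n)

theorem VonNeumannAlgebra.containsKernelLimits (M : VonNeumannAlgebra H) :
    M.toStarSubalgebra.ContainsKernelLimits := fun _ hb _ _ _ hQ =>
  M.mem_of_tendsto (fun n => pow_mem (sub_mem (one_mem M) hb) n) hQ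

instance VonNeumannAlgebra.isClosed (M : VonNeumannAlgebra H) :
    IsClosed (M.toStarSubalgebra : Set (H →L[ℂ] H)) := by
  rw [VonNeumannAlgebra.coe_toStarSubalgebra, ← M.centralizer_centralizer]
  exact Set.isClosed_centralizer _

end UnitaryConnected

/-! ### Positivity and normality of the expectation -/

section Expectation

variable {H : Type*} [NormedAddCommGroup H] [InnerProductSpace ℂ H] [CompleteSpace H]
  {M N : VonNeumannAlgebra H} (E : FaithfulNormalCondExp M N)

namespace FaithfulNormalCondExp

theorem map_isSelfAdjoint {x : M.toStarSubalgebra} (hx : IsSelfAdjoint x) :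
    IsSelfAdjoint (E.toCLM x) := by
  have hx' : IsSelfAdjoint (x : H →L[ℂ] H) := congrArg Subtype.val hx
  have hn1 (r : ℝ) : E.toCLM ((r : ℂ) • 1) = (r : ℂ) • 1 := by
    rw [map_smul, E.map_of_mem 1 (one_mem N)]
  -- both `‖x‖ - x` and its image are positive, hence self-adjoint
  have hpos : 0 ≤ (((‖x‖ : ℂ) • 1 - x : M.toStarSubalgebra) : H →L[ℂ] H) := by
    have h := sub_nonneg.2 hx'.le_algebraMap_norm_self
    rw [Algebra.algebraMap_eq_smul_one] at h
    exact h
  have h1 := IsSelfAdjoint.of_nonneg (E.map_nonneg _ hpos)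
  have h2 : IsSelfAdjoint (E.toCLM ((‖x‖ : ℂ) • 1 - x)) := Subtype.ext h1
  rw [map_sub, hn1] at h2
  have h3 : IsSelfAdjoint ((‖x‖ : ℂ) • (1 : M.toStarSubalgebra)) := by
    rw [IsSelfAdjoint, star_smul, star_one]
    simp
  simpa using h3.sub h2

theorem map_star (x : M.toStarSubalgebra) : E.toCLM (star x) = star (E.toCLM x) := by
  have h1 := E.map_isSelfAdjoint (IsSelfAdjoint.add_star_self x)
  have h2 : IsSelfAdjoint (Complex.I • (x - star x)) := by
    rw [IsSelfAdjoint, star_smul, star_sub, star_star]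
    simp [smul_sub, neg_add_eq_sub]
  replace h2 := E.map_isSelfAdjoint h2
  rw [map_add, IsSelfAdjoint, star_add] at h1
  rw [map_smul, map_sub, IsSelfAdjoint, star_smul, star_sub] at h2
  have h3 : star (E.toCLM x) - star (E.toCLM (star x)) = -(E.toCLM x - E.toCLM (star x)) := by
    have h := congrArg (fun y => Complex.I • y) h2
    simpa [smul_smul] using h
  -- adding the equations for the real and imaginary parts
  have h4 : (2 : ℂ) • star (E.toCLM x) = (2 : ℂ) • E.toCLM (star x) := by
    rw [two_smul, two_smul]
    calc star (E.toCLM x) + star (E.toCLM x)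
        = (star (E.toCLM x) + star (E.toCLM (star x))) +
          (star (E.toCLM x) - star (E.toCLM (star x))) := by abel
      _ = E.toCLM (star x) + E.toCLM (star x) := by rw [h1, h3]; abel
  exact (smul_right_injective _ (two_ne_zero (α := ℂ)) h4).symm

/-- The Cauchy–Schwarz inequality for the positive functional `x ↦ ⟪ξ, E(x) ξ⟫`. -/
theorem norm_inner_map_mul_sq_le (x y : M.toStarSubalgebra) (ξ : H) :
    ‖inner ℂ ξ ((E.toCLM (star x * y) : H →L[ℂ] H) ξ)‖ ^ 2 ≤
      RCLike.re (inner ℂ ξ ((E.toCLM (star x * x) : H →L[ℂ] H) ξ)) *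
        RCLike.re (inner ℂ ξ ((E.toCLM (star y * y) : H →L[ℂ] H) ξ)) := by
  have hsymm (x y : M.toStarSubalgebra) :
      (starRingEnd ℂ) (inner ℂ ξ ((E.toCLM (star y * x) : H →L[ℂ] H) ξ)) =
        inner ℂ ξ ((E.toCLM (star x * y) : H →L[ℂ] H) ξ) := by
    have h : star x * y = star (star y * x) := by simp
    rw [h, E.map_star, inner_conj_symm]
    exact (ContinuousLinearMap.adjoint_inner_right (E.toCLM (star y * x) : H →L[ℂ] H) ξ ξ).symm
  let c : PreInnerProductSpace.Core ℂ M.toStarSubalgebra :=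
    { inner := fun x y => inner ℂ ξ ((E.toCLM (star x * y) : H →L[ℂ] H) ξ)
      conj_inner_symm := hsymm
      re_inner_nonneg := fun x => by
        have hx : 0 ≤ ((star x * x : M.toStarSubalgebra) : H →L[ℂ] H) :=
          star_mul_self_nonneg (x : H →L[ℂ] H)
        exact ((ContinuousLinearMap.nonneg_iff_isPositive _).1
          (E.map_nonneg _ hx)).re_inner_nonneg_right ξ
      add_left := fun x y z => by simp [add_mul]
      smul_left := fun x y r => by simp }
  have h := InnerProductSpace.Core.inner_mul_inner_self_le (c := c) x y
  have h2 : ‖inner ℂ ξ ((E.toCLM (star y * x) : H →L[ℂ] H) ξ)‖ =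
      ‖inner ℂ ξ ((E.toCLM (star x * y) : H →L[ℂ] H) ξ)‖ := by
    rw [← hsymm, RCLike.norm_conj]
  rw [sq]
  nth_rewrite 2 [← h2]
  exact h

theorem map_mono {x y : M.toStarSubalgebra} (h : x ≤ y) : E.toCLM x ≤ E.toCLM y := by
  have := E.map_nonneg (y - x) (sub_nonneg.2 (show (x : H →L[ℂ] H) ≤ y from h))
  rw [map_sub] at this
  exact (sub_nonneg (α := H →L[ℂ] H)).1 this

/-- By normality, `E` maps the sequence `(1 - b) ^ n - Q`, which decreases strongly to `0`, to a
sequence converging strongly to `0`. -/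
theorem tendsto_map_pow_sub {b Q : M.toStarSubalgebra} (h0 : 0 ≤ (b : H →L[ℂ] H))
    (h1 : (b : H →L[ℂ] H) ≤ 1) (hQ : IsKernelLimit (b : H →L[ℂ] H) Q) (ξ : H) :
    Tendsto (fun n : ℕ => (E.toCLM ((1 - b) ^ n - Q) : H →L[ℂ] H) ξ) atTop (𝓝 0) := by
  have hanti : Antitone fun n : ℕ => (1 - b) ^ n := fun n m hnm =>
    ContinuousLinearMap.antitone_one_sub_pow h0 h1 hnm
  have hpos (n : ℕ) : 0 ≤ ((1 - b) ^ n - Q : M.toStarSubalgebra) :=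
    show 0 ≤ (1 - (b : H →L[ℂ] H)) ^ n - Q from sub_nonneg.2 (hQ.le_one_sub_pow h0 h1 n)
  have hbs : IsSelfAdjoint b := Subtype.ext (IsSelfAdjoint.of_nonneg h0)
  have hlub : IsLUB (Set.range fun n : ℕ => 1 - (1 - b) ^ n) (1 - Q) := by
    constructor
    · rintro _ ⟨n, rfl⟩
      exact sub_le_sub_left (α := H →L[ℂ] H) (hQ.le_one_sub_pow h0 h1 n) 1
    · intro y hy
      have h (n : ℕ) : 0 ≤ (1 - (b : H →L[ℂ] H)) ^ n - (1 - y) :=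
        sub_nonneg.2 (sub_le_comm.1 (show 1 - (1 - (b : H →L[ℂ] H)) ^ n ≤ y from hy ⟨n, rfl⟩))
      have h' := ContinuousLinearMap.nonneg_of_tendsto (T := (Q : H →L[ℂ] H) - (1 - (y : H →L[ℂ] H))) h
        fun ξ => (hQ ξ).sub (tendsto_const_nhds (x := (1 - (y : H →L[ℂ] H)) ξ))
      exact sub_le_comm.1 (sub_nonneg.1 h')
  have hlubE := E.normal _ _ (Set.range_nonempty _)
    (directedOn_range.2 (Monotone.directed_le fun n m hnm =>
      sub_le_sub_left (α := H →L[ℂ] H) (hanti hnm) 1))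
    (by
      rintro _ ⟨n, rfl⟩
      exact (IsSelfAdjoint.one _).sub (((IsSelfAdjoint.one _).sub hbs).pow n)) hlub
  have hEanti : Antitone fun n : ℕ => (E.toCLM ((1 - b) ^ n - Q) : H →L[ℂ] H) := fun n m hnm =>
    E.map_mono (sub_le_sub_right (α := H →L[ℂ] H) (hanti hnm) _)
  have hEpos (n : ℕ) : 0 ≤ (E.toCLM ((1 - b) ^ n - Q) : H →L[ℂ] H) := E.map_nonneg _ (hpos n)
  obtain ⟨T, hT⟩ := ContinuousLinearMap.exists_tendsto_of_antitone hEanti hEpos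
  have hT0 : 0 ≤ T := ContinuousLinearMap.nonneg_of_tendsto hEpos hT
  have hTM : T ∈ M := M.mem_of_tendsto (fun n => (E.toCLM ((1 - b) ^ n - Q)).2) hT
  -- `E (1 - Q) - T` is an upper bound as well, so that `T ≤ 0`
  have hub : E.toCLM (1 - Q) - ⟨T, hTM⟩ ∈
      upperBounds (E.toCLM '' Set.range fun n : ℕ => 1 - (1 - b) ^ n) := by
    rintro _ ⟨_, ⟨n, rfl⟩, rfl⟩
    have hTn : 0 ≤ (E.toCLM ((1 - b) ^ n - Q) : H →L[ℂ] H) - T := by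
      refine ContinuousLinearMap.nonneg_of_tendsto (y := fun m =>
        (E.toCLM ((1 - b) ^ n - Q) : H →L[ℂ] H) -
          (E.toCLM ((1 - b) ^ (m + n) - Q) : H →L[ℂ] H))
        (fun m => sub_nonneg.2 (hEanti (Nat.le_add_left n m)))
        fun ξ => tendsto_const_nhds.sub ((tendsto_add_atTop_iff_nat n).2 (hT ξ))
    have he : (1 - b) ^ n - Q = (1 - Q) - (1 - (1 - b) ^ n) := by abel
    rw [he, map_sub] at hTn
    change (E.toCLM (1 - (1 - b) ^ n) : H →L[ℂ] H) ≤ (E.toCLM (1 - Q) : H →L[ℂ] H) - T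
    refine le_sub_comm.1 (sub_nonneg.1 hTn)
  have hle : (E.toCLM (1 - Q) : H →L[ℂ] H) ≤ (E.toCLM (1 - Q) : H →L[ℂ] H) - T := hlubE.2 hub
  have hTz : T = 0 := le_antisymm (by simpa using hle) hT0
  simpa [hTz] using hT ξ

/-- By Cauchy–Schwarz, `E(((1 - b) ^ n - Q) m)` converges weakly to `0` for every `m` in `M`. -/
theorem tendsto_inner_map_mul {b Q : M.toStarSubalgebra} (h0 : 0 ≤ (b : H →L[ℂ] H))
    (h1 : (b : H →L[ℂ] H) ≤ 1) (hQ : IsKernelLimit (b : H →L[ℂ] H) Q) (m : M.toStarSubalgebra)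
    (ξ : H) : Tendsto (fun n : ℕ => inner ℂ ξ
      ((E.toCLM (((1 - b) ^ n - Q) * m) : H →L[ℂ] H) ξ)) atTop (𝓝 0) := by
  have hQs : star Q = Q := Subtype.ext (IsSelfAdjoint.of_nonneg (hQ.nonneg h1)).star_eq
  have hbs : star b = b := Subtype.ext (IsSelfAdjoint.of_nonneg h0).star_eq
  have hds (n : ℕ) : star ((1 - b) ^ n - Q) = (1 - b) ^ n - Q := by simp [hQs, hbs]
  set C := RCLike.re (inner ℂ ξ ((E.toCLM (star m * m) : H →L[ℂ] H) ξ)) with hC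
  have hC0 : 0 ≤ C := ((ContinuousLinearMap.nonneg_iff_isPositive _).1
    (E.map_nonneg _ (star_mul_self_nonneg (m : H →L[ℂ] H)))).re_inner_nonneg_right ξ
  -- `d ^ 2 ≤ d` for `d = (1 - b) ^ n - Q`
  have hdd (n : ℕ) : star ((1 - b) ^ n - Q) * ((1 - b) ^ n - Q) ≤ (1 - b) ^ n - Q := by
    have hQb : (Q : H →L[ℂ] H) * b = 0 := hQ.mul_eq_zero
    have hQp : Q * (1 - b) ^ n = Q := Subtype.ext (IsKernelLimit.mul_one_sub_pow hQb n)
    have hQp' : (1 - b) ^ n * Q = Q := by simpa [hQs, hbs] using congrArg star hQp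
    have hQQ : Q * Q = Q := Subtype.ext hQ.isIdempotentElem
    have he : ((1 - b) ^ n - Q) * ((1 - b) ^ n - Q) = (1 - b) ^ (n + n) - Q := by
      rw [pow_add]; simp [mul_sub, sub_mul, hQp, hQp', hQQ]
    rw [hds, he]
    exact sub_le_sub_right (α := H →L[ℂ] H)
      (ContinuousLinearMap.antitone_one_sub_pow h0 h1 (Nat.le_add_left n n)) _
  have hbound (n : ℕ) : ‖inner ℂ ξ ((E.toCLM (((1 - b) ^ n - Q) * m) : H →L[ℂ] H) ξ)‖ ^ 2 ≤
      RCLike.re (inner ℂ ξ ((E.toCLM ((1 - b) ^ n - Q) : H →L[ℂ] H) ξ)) * C := by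
    have h := E.norm_inner_map_mul_sq_le ((1 - b) ^ n - Q) m ξ
    rw [hds] at h
    refine h.trans (mul_le_mul_of_nonneg_right ?_ hC0)
    have h2 := E.map_mono (hdd n)
    rw [hds] at h2
    have h3 := ((ContinuousLinearMap.le_def _ _).1 h2).re_inner_nonneg_right ξ
    simpa [inner_sub_right] using h3
  have hlim : Tendsto (fun n : ℕ => RCLike.re (inner ℂ ξ
      ((E.toCLM ((1 - b) ^ n - Q) : H →L[ℂ] H) ξ)) * C) atTop (𝓝 0) := by
    have h := ((RCLike.continuous_re (K := ℂ)).tendsto _).comp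
      (tendsto_const_nhds (x := ξ) |>.inner (𝕜 := ℂ) (E.tendsto_map_pow_sub h0 h1 hQ ξ))
    simpa only [inner_zero_right, map_zero, zero_mul, Function.comp_apply] using h.mul_const C
  have hsq := squeeze_zero (fun n => sq_nonneg _) hbound hlim
  rw [tendsto_zero_iff_norm_tendsto_zero]
  simpa [Real.sqrt_sq] using hsq.sqrt

/-- The centralizer `M_E` contains the kernel projections of its positive contractions. -/
theorem kernelLimit_mem_centralizer {b Q : M.toStarSubalgebra} (hb : b ∈ E.centralizer)
    (h0 : 0 ≤ (b : H →L[ℂ] H)) (h1 : (b : H →L[ℂ] H) ≤ 1)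
    (hQ : IsKernelLimit (b : H →L[ℂ] H) Q) : Q ∈ E.centralizer := by
  have hQs : star Q = Q := Subtype.ext (IsSelfAdjoint.of_nonneg (hQ.nonneg h1)).star_eq
  have hbs : star b = b := Subtype.ext (IsSelfAdjoint.of_nonneg h0).star_eq
  refine ⟨N.commutant.containsKernelLimits _ hb.1 h0 h1 _ hQ, fun m => ?_⟩
  have hpow (n : ℕ) : ∀ m, E.toCLM ((1 - b) ^ n * m) = E.toCLM (m * (1 - b) ^ n) := by
    induction n with
    | zero => simp
    | succ n ih =>
      intro m
      have h : ∀ m, E.toCLM ((1 - b) * m) = E.toCLM (m * (1 - b)) := fun m => by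
        simp only [sub_mul, mul_sub, map_sub, one_mul, mul_one, hb.2]
      rw [pow_succ, mul_assoc, ih, mul_assoc, h, mul_assoc]
  have hl := E.tendsto_inner_map_mul h0 h1 hQ m
  have hr (ξ : H) : Tendsto (fun n : ℕ => inner ℂ ξ
      ((E.toCLM (m * ((1 - b) ^ n - Q)) : H →L[ℂ] H) ξ)) atTop (𝓝 0) := by
    have h := ((RCLike.continuous_conj (K := ℂ)).tendsto _).comp
      (E.tendsto_inner_map_mul h0 h1 hQ (star m) ξ)
    rw [map_zero] at h
    refine h.congr fun n => ?_
    have he : ((1 - b) ^ n - Q) * star m = star (m * ((1 - b) ^ n - Q)) := by simp [hQs, hbs]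
    rw [Function.comp_apply, he, E.map_star, inner_conj_symm]
    exact ContinuousLinearMap.adjoint_inner_left (E.toCLM (m * ((1 - b) ^ n - Q)) : H →L[ℂ] H) ξ ξ
  have hz : ((E.toCLM (Q * m) - E.toCLM (m * Q) : M.toStarSubalgebra) : H →L[ℂ] H) = 0 := by
    refine ContinuousLinearMap.coe_injective ((inner_map_self_eq_zero _).1 fun ξ => ?_)
    rw [inner_eq_zero_symm]
    have h := (hr ξ).sub (hl ξ)
    rw [sub_zero] at h
    refine tendsto_nhds_unique (tendsto_const_nhds.congr fun n => ?_) h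
    have he : E.toCLM (Q * m) - E.toCLM (m * Q) =
        E.toCLM (m * ((1 - b) ^ n - Q)) - E.toCLM (((1 - b) ^ n - Q) * m) := by
      rw [mul_sub, sub_mul, map_sub, map_sub, hpow]
      abel
    rw [← inner_sub_right, ← sub_apply]
    exact congrArg (fun x : M.toStarSubalgebra => inner ℂ ξ ((x : H →L[ℂ] H) ξ)) he
  exact sub_eq_zero.1 (Subtype.ext hz)

end FaithfulNormalCondExp

end Expectation

/-! ### The identity component of the normalizer -/

section Polar

variable {A : Type*} [CStarAlgebra A] [PartialOrder A] [StarOrderedRing A]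

/-- The unitary part `y (y* y)^{-1/2}` of the polar decomposition of an invertible element `y`. -/
theorem IsUnit.exists_mul_mem_unitary {y : A} (hy : IsUnit y) :
    ∃ k : A, y * k ∈ unitary A ∧ ∀ x, Commute (star y * y) x → Commute k x := by
  have hu : IsUnit (star y * y) := hy.star.mul hy
  have h0 : 0 ≤ star y * y := star_mul_self_nonneg y
  set k : A := (star y * y) ^ (-(1 / 2) : ℝ) with hk
  have hks : IsSelfAdjoint k := .of_nonneg CFC.rpow_nonneg
  have hkk : k * (star y * y) * k = 1 := by
    have h1 : star y * y = (star y * y) ^ (1 : ℝ) := (CFC.rpow_one _).symm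
    have h2 : k * (star y * y) ^ (1 : ℝ) * k = 1 := by
      rw [hk, ← CFC.rpow_add hu, ← CFC.rpow_add hu]
      norm_num
      exact CFC.rpow_zero _
    rwa [← h1] at h2
  have hku : IsUnit k := hu.cfcRpow _ h0
  refine ⟨k, ?_, fun x hx => hx.cfc_nnreal _⟩
  have h1 : star (y * k) * (y * k) = 1 := by
    rw [star_mul, hks.star_eq]
    simpa only [mul_assoc] using hkk
  refine Unitary.mem_iff.2 ⟨h1, ?_⟩
  obtain ⟨v, hv⟩ := hy.mul hku
  rw [← hv] at h1 ⊢
  rw [← Units.inv_eq_of_mul_eq_one_left h1, Units.mul_inv]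

end Polar

section Expectation

variable {H : Type*} [NormedAddCommGroup H] [InnerProductSpace ℂ H] [CompleteSpace H]
  {M N : VonNeumannAlgebra H}

theorem VonNeumannAlgebra.mem_of_commute {x : H →L[ℂ] H}
    (h : ∀ y ∈ M.commutant, Commute x y) : x ∈ M := by
  rw [← M.commutant_commutant, VonNeumannAlgebra.mem_commutant_iff]
  exact fun g hg => (h g hg).eq.symm

/-- A unitary of `M` in a star subalgebra that is closed under kernel projections is joined to `1`
within that subalgebra. -/
theorem StarSubalgebra.ContainsKernelLimits.joinedIn_one {S : StarSubalgebra ℂ (H →L[ℂ] H)}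
    [IsClosed (S : Set (H →L[ℂ] H))] (hS : S.ContainsKernelLimits) (hSM : S ≤ M.toStarSubalgebra)
    (u : unitary M.toStarSubalgebra) (hu : ((u : M.toStarSubalgebra) : H →L[ℂ] H) ∈ S) :
    JoinedIn {v : unitary M.toStarSubalgebra | ((v : M.toStarSubalgebra) : H →L[ℂ] H) ∈ S} 1 u := by
  let u' : unitary S := ⟨⟨_, hu⟩, Unitary.mem_iff.2
    ⟨Subtype.ext (congrArg (Subtype.val : M.toStarSubalgebra → _) (Unitary.coe_star_mul_self u)),
      Subtype.ext (congrArg (Subtype.val : M.toStarSubalgebra → _) (Unitary.coe_mul_star_self u))⟩⟩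
  obtain ⟨γ⟩ := hS.joined_one u'
  let ι : unitary S → unitary M.toStarSubalgebra := fun w =>
    ⟨StarSubalgebra.inclusion hSM w, Unitary.map_mem _ w.2⟩
  have hι : Continuous ι :=
    Continuous.subtype_mk ((continuous_subtype_val.comp continuous_subtype_val).subtype_mk _) _
  refine ⟨(γ.map hι).cast (Subtype.ext (map_one (StarSubalgebra.inclusion hSM)).symm) rfl, fun t => ?_⟩
  exact ((γ t : unitary S) : S).2

namespace FaithfulNormalCondExp

variable (E : FaithfulNormalCondExp M N)

/-- The centralizer `M_E` as a star algebra of operators on `H`. -/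
def centralizerSubalgebra : StarSubalgebra ℂ (H →L[ℂ] H) where
  carrier := Subtype.val '' E.centralizer
  mul_mem' := by
    rintro _ _ ⟨x, hx, rfl⟩ ⟨y, hy, rfl⟩
    refine ⟨x * y, ⟨mul_mem hx.1 hy.1, fun m => ?_⟩, rfl⟩
    rw [mul_assoc, hx.2, mul_assoc, hy.2, mul_assoc]
  add_mem' := by
    rintro _ _ ⟨x, hx, rfl⟩ ⟨y, hy, rfl⟩
    refine ⟨x + y, ⟨add_mem hx.1 hy.1, fun m => ?_⟩, rfl⟩
    rw [add_mul, mul_add, map_add, map_add, hx.2, hy.2]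
  algebraMap_mem' r := by
    refine ⟨algebraMap ℂ _ r, ⟨N.commutant.algebraMap_mem' r, fun m => ?_⟩, rfl⟩
    rw [Algebra.commutes]
  star_mem' := by
    rintro _ ⟨x, hx, rfl⟩
    refine ⟨star x, ⟨star_mem hx.1, fun m => ?_⟩, rfl⟩
    have h := congrArg star (hx.2 (star m))
    rw [← E.map_star, ← E.map_star, star_mul, star_mul, star_star] at h
    exact h.symm

instance isClosed_centralizerSubalgebra :
    IsClosed (E.centralizerSubalgebra : Set (H →L[ℂ] H)) := by
  have h : IsClosed E.centralizer := by
    refine IsClosed.inter ?_ ?_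
    · exact (N.commutant.isClosed).preimage continuous_subtype_val
    · change IsClosed {x : M.toStarSubalgebra | ∀ m, E.toCLM (x * m) = E.toCLM (m * x)}
      rw [Set.ofPred_forall]
      exact isClosed_iInter fun m => isClosed_eq (by fun_prop) (by fun_prop)
  exact M.isClosed.isClosedEmbedding_subtypeVal.isClosedMap _ h

theorem containsKernelLimits_centralizerSubalgebra :
    E.centralizerSubalgebra.ContainsKernelLimits := by
  rintro _ ⟨b, hb, rfl⟩ h0 h1 Q hQ
  exact ⟨⟨Q, M.containsKernelLimits _ b.2 h0 h1 Q hQ⟩,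
    E.kernelLimit_mem_centralizer hb h0 h1 hQ, rfl⟩

theorem joinedIn_unitaryProduct {u : unitary M.toStarSubalgebra} (hu : u ∈ E.unitaryProduct) :
    JoinedIn (E.unitaryProduct : Set (unitary M.toStarSubalgebra)) 1 u := by
  obtain ⟨v, w, hv, hw, rfl⟩ := hu
  obtain ⟨γ, hγ⟩ := N.containsKernelLimits.joinedIn_one E.le v hv
  obtain ⟨δ, hδ⟩ := E.containsKernelLimits_centralizerSubalgebra.joinedIn_one (M := M)
    (by rintro _ ⟨x, -, rfl⟩; exact x.2) w ⟨w, hw, rfl⟩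
  refine ⟨(γ.mul δ).cast (one_mul 1).symm rfl, fun t => ⟨γ t, δ t, hγ t, ?_, rfl⟩⟩
  obtain ⟨x, hx, hxe⟩ := hδ t
  rwa [← Subtype.ext hxe]

theorem pathConnectedSpace_unitary : PathConnectedSpace (unitary M.toStarSubalgebra) :=
  { nonempty := ⟨1⟩
    joined := fun u v => ((M.containsKernelLimits.joined_one u).symm).trans
      (M.containsKernelLimits.joined_one v) }

/-- If `u` normalizes `E` and `E(u)` is invertible, then `u` is the product of the unitary part `v`
of `E(u)` and of `v* u`, which lies in the centralizer of `E`. -/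
theorem mem_unitaryProduct_of_isUnit {u : unitary M.toStarSubalgebra} (hu : u ∈ E.normalizer)
    (hy : IsUnit (E.toCLM u : H →L[ℂ] H)) : u ∈ E.unitaryProduct := by
  set U : H →L[ℂ] H := ((u : M.toStarSubalgebra) : H →L[ℂ] H) with hU
  set y : H →L[ℂ] H := (E.toCLM u : H →L[ℂ] H) with hydef
  have hU1 : star U * U = 1 := congrArg Subtype.val (Unitary.coe_star_mul_self u)
  have hU2 : U * star U = 1 := congrArg Subtype.val (Unitary.coe_mul_star_self u)
  have hyN : y ∈ N := E.map_mem _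
  -- the two evaluations of `E(u n) = E((u n u*) u)` by the bimodule property
  have hyn (n : H →L[ℂ] H) (hn : n ∈ N) : y * n = U * n * star U * y := by
    let n' : M.toStarSubalgebra := ⟨n, E.le hn⟩
    have h1 := hu n'
    rw [E.map_of_mem n' hn] at h1
    have hmem : ((u * n' * star (u : M.toStarSubalgebra) : M.toStarSubalgebra) : H →L[ℂ] H) ∈ N :=
      h1 ▸ E.map_mem _
    have h2 := E.map_bimodule 1 u n' (one_mem N) hn
    have h3 := E.map_bimodule (u * n' * star (u : M.toStarSubalgebra)) u 1 hmem (one_mem N)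
    have h4 : u * n' * star (u : M.toStarSubalgebra) * u = u * n' := by
      rw [mul_assoc, Unitary.coe_star_mul_self, mul_one]
    rw [mul_one, mul_one, h4] at h3
    rw [one_mul, one_mul] at h2
    exact congrArg Subtype.val (h2.symm.trans h3)
  have hz : star U * y ∈ N.commutant := by
    refine VonNeumannAlgebra.mem_commutant_iff.2 fun n hn => ?_
    rw [mul_assoc, hyn n hn, ← mul_assoc, ← mul_assoc, ← mul_assoc, ← mul_assoc, hU1, one_mul]
  have hyy : star y * y = star (star U * y) * (star U * y) := by
    rw [star_mul, star_star, mul_assoc, ← mul_assoc U, hU2, one_mul]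
  obtain ⟨k, hkU, hk⟩ := hy.exists_mul_mem_unitary
  have hkN : k ∈ N := VonNeumannAlgebra.mem_of_commute fun x hx => hk x
    (VonNeumannAlgebra.mem_commutant_iff.1 hx _ (mul_mem (star_mem hyN) hyN))
  have hkN' : k ∈ N.commutant := VonNeumannAlgebra.mem_of_commute fun x hx => hk x <| by
    rw [hyy]
    exact VonNeumannAlgebra.mem_commutant_iff.1 hx _ (mul_mem (star_mem hz) hz)
  have hvN : y * k ∈ N := mul_mem hyN hkN
  let v : unitary M.toStarSubalgebra := ⟨⟨y * k, E.le hvN⟩, Unitary.mem_iff.2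
    ⟨Subtype.ext hkU.1, Subtype.ext hkU.2⟩⟩
  have hv : v ∈ E.unitaryProduct := ⟨v, 1, hvN, by simp [centralizer], by simp⟩
  have hw : v⁻¹ * u ∈ E.normalizer := mul_mem (inv_mem (E.unitaryProduct_le_normalizer hv)) hu
  have hwN' : (((v⁻¹ * u : unitary M.toStarSubalgebra) : M.toStarSubalgebra) : H →L[ℂ] H) ∈
      N.commutant := by
    have h := star_mem (mul_mem hz hkN')
    have he : star (star U * y * k) = star (y * k) * U := by
      rw [mul_assoc, star_mul, star_star]
    rw [he] at h
    exact h
  refine ⟨v, v⁻¹ * u, hvN, ⟨hwN', fun m => ?_⟩, by simp⟩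
  generalize v⁻¹ * u = w at hw hwN'
  have hw1 : (w : M.toStarSubalgebra) * star (w : M.toStarSubalgebra) = 1 :=
    Unitary.coe_mul_star_self w
  -- the normalizer relation at `m w`; both `w` and `w*` commute with the values of `E`
  have h1 := hw (m * w)
  have h2 : (w : M.toStarSubalgebra) * E.toCLM (m * w) = E.toCLM (m * w) * w :=
    Subtype.ext (VonNeumannAlgebra.mem_commutant_iff.1 hwN' _ (E.map_mem _)).symm
  rwa [h2, mul_assoc (E.toCLM _), hw1, mul_one, ← mul_assoc, mul_assoc, hw1, mul_one] at h1

/-- `H_E` contains the elements of `N_E` near `1`. -/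
theorem exists_nhds_one_normalizer_subset_unitaryProduct :
    ∃ O ∈ 𝓝 (1 : unitary M.toStarSubalgebra), ∀ u ∈ O, u ∈ E.normalizer → u ∈ E.unitaryProduct := by
  have hc : Continuous fun u : unitary M.toStarSubalgebra =>
      (E.toCLM (u : M.toStarSubalgebra) : H →L[ℂ] H) := by fun_prop
  -- `E(u)` depends continuously on `u` and `E(1) = 1` is invertible
  refine ⟨{u | IsUnit (E.toCLM (u : M.toStarSubalgebra) : H →L[ℂ] H)},
    (Units.isOpen.preimage hc).mem_nhds ?_, fun u hu hun => E.mem_unitaryProduct_of_isUnit hun hu⟩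
  have h1 : E.toCLM 1 = 1 := E.map_of_mem 1 (one_mem N)
  change IsUnit (E.toCLM ((1 : unitary M.toStarSubalgebra) : M.toStarSubalgebra) : H →L[ℂ] H)
  rw [OneMemClass.coe_one, h1]
  exact isUnit_one

/-- `H_E` is the identity component of `N_E`: it is path connected, and it is open in `N_E`. -/
theorem connectedComponentOfOne_normalizer :
    Subgroup.connectedComponentOfOne E.normalizer = E.unitaryProduct.subgroupOf E.normalizer := by
  apply le_antisymm
  · have hopen : IsOpen (E.unitaryProduct.subgroupOf E.normalizer : Set E.normalizer) := by
      obtain ⟨O, hO, h⟩ := E.exists_nhds_one_normalizer_subset_unitaryProduct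
      refine Subgroup.isOpen_of_mem_nhds _ (g := 1) ?_
      filter_upwards [continuous_subtype_val.continuousAt.preimage_mem_nhds
        (x := (1 : E.normalizer)) hO] with u hu
      exact h u hu u.2
    have hclopen : IsClopen (E.unitaryProduct.subgroupOf E.normalizer : Set E.normalizer) :=
      ⟨Subgroup.isClosed_of_isOpen _ hopen, hopen⟩
    exact hclopen.connectedComponent_subset (one_mem _)
  · intro u hu
    have h := (E.joinedIn_unitaryProduct (Subgroup.mem_subgroupOf.1 hu)).mono
      E.unitaryProduct_le_normalizer
    exact pathComponent_subset_component _ h.joined_subtype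

/-! ### The covering of the unitary orbit -/

/-- The fibres of `U_M → U(E)` are the left cosets of `N_E`. -/
theorem coveringMap_eq_iff (u v : unitary M.toStarSubalgebra) :
    E.coveringMap (u : E.CoverSpace) = E.coveringMap (v : E.CoverSpace) ↔
      u⁻¹ * v ∈ E.normalizer := by
  have hu1 : (u : M.toStarSubalgebra) * star (u : M.toStarSubalgebra) = 1 :=
    Unitary.coe_mul_star_self u
  have hu2 := Unitary.coe_star_mul_self u
  have hv1 : (v : M.toStarSubalgebra) * star (v : M.toStarSubalgebra) = 1 :=
    Unitary.coe_mul_star_self v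
  have hv2 := Unitary.coe_star_mul_self v
  have hcov : E.coveringMap (u : E.CoverSpace) = E.coveringMap (v : E.CoverSpace) ↔
      ∀ x : M.toStarSubalgebra,
        (u : M.toStarSubalgebra) * E.toCLM (star (u : M.toStarSubalgebra) * x * u) *
            star (u : M.toStarSubalgebra) =
          v * E.toCLM (star (v : M.toStarSubalgebra) * x * v) * star (v : M.toStarSubalgebra) :=
    Subtype.ext_iff.trans ContinuousLinearMap.ext_iff
  have hnorm : u⁻¹ * v ∈ E.normalizer ↔ ∀ x : M.toStarSubalgebra,
      E.toCLM (star (u : M.toStarSubalgebra) * v * x * (star (v : M.toStarSubalgebra) * u)) =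
        star (u : M.toStarSubalgebra) * v * E.toCLM x * (star (v : M.toStarSubalgebra) * u) := by
    have he : star ((u⁻¹ * v : unitary M.toStarSubalgebra) : M.toStarSubalgebra) =
        star (v : M.toStarSubalgebra) * u := by
      rw [Submonoid.coe_mul, star_mul, ← Unitary.star_eq_inv, Unitary.coe_star, star_star]
    change (∀ x, E.toCLM (_ * x * star ((u⁻¹ * v : unitary _) : M.toStarSubalgebra)) =
      _ * E.toCLM x * star ((u⁻¹ * v : unitary _) : M.toStarSubalgebra)) ↔ _
    rw [he]
    rfl
  rw [hcov, hnorm]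
  generalize (u : M.toStarSubalgebra) = a at *
  generalize (v : M.toStarSubalgebra) = b at *
  generalize star a = a' at *
  generalize star b = b' at *
  have ha (x : M.toStarSubalgebra) : a' * (a * x) = x := by rw [← mul_assoc, hu2, one_mul]
  have ha' (x : M.toStarSubalgebra) : a * (a' * x) = x := by rw [← mul_assoc, hu1, one_mul]
  have hb (x : M.toStarSubalgebra) : b' * (b * x) = x := by rw [← mul_assoc, hv2, one_mul]
  have hb' (x : M.toStarSubalgebra) : b * (b' * x) = x := by rw [← mul_assoc, hv1, one_mul]
  constructor
  · intro h x
    have h1 := congrArg (fun y => a' * y * a) (h (b * x * b'))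
    simpa only [mul_assoc, ha, hb, hu2, hv2, mul_one] using h1
  · intro h x
    have h1 := congrArg (fun y => a * y * a') (h (b' * x * b))
    simpa only [mul_assoc, ha', hb', hu1, hv1, mul_one] using h1

theorem isQuotientCoveringMap_coveringMap :
    let := E.unitaryProduct.cosetMulAction E.normalizer E.unitaryProduct_le_normalizer
    IsQuotientCoveringMap E.coveringMap
      (E.normalizer ⧸ E.unitaryProduct.subgroupOf E.normalizer) := by
  obtain ⟨O, hO, h⟩ := E.exists_nhds_one_normalizer_subset_unitaryProduct
  refine Subgroup.isQuotientCoveringMap_coset _ _ _ hO h _ ?_ E.coveringMap_eq_iff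
  exact { eq_coinduced := rfl, surjective := by rintro ⟨_, u, rfl⟩; exact ⟨u, rfl⟩ }

end FaithfulNormalCondExp

end Expectation

theorem mainTheorem3 {H : Type*} [NormedAddCommGroup H] [InnerProductSpace ℂ H] [CompleteSpace H]
    (M N : VonNeumannAlgebra H) (E : FaithfulNormalCondExp M N)
    (x₀ : E.CoverSpace) :
    ∃ _ : (FundamentalGroup.map E.coveringMap x₀).range.Normal,
      Nonempty
        ((FundamentalGroup E.UnitaryOrbit (E.coveringMap x₀) ⧸
          (FundamentalGroup.map E.coveringMap x₀).range) ≃* E.WeylGroup) ∧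
      Nonempty
        ((FundamentalGroup E.UnitaryOrbit (E.coveringMap x₀) ⧸
          (FundamentalGroup.map E.coveringMap x₀).range) ≃*
            (E.normalizer ⧸ E.unitaryProduct.subgroupOf E.normalizer)) := by
  have := FaithfulNormalCondExp.pathConnectedSpace_unitary (M := M)
  have : PathConnectedSpace E.CoverSpace := Quotient.instPathConnectedSpace
  let := E.unitaryProduct.cosetMulAction E.normalizer E.unitaryProduct_le_normalizer
  obtain ⟨hn, ⟨e⟩⟩ := E.isQuotientCoveringMap_coveringMap.exists_normal_quotient_range_mulEquiv
    E.coveringMap x₀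
  exact ⟨hn, ⟨e.trans (QuotientGroup.quotientMulEquivOfEq
    E.connectedComponentOfOne_normalizer.symm)⟩, ⟨e⟩⟩
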